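/- Let $G$ be a finite group. A set $\delta$ of proper subgroups of $G$ is called a covering of $G$ if $G$ is the set-theoretical union of the members of $\delta$ and no member of $\delta$ is contained in a different member of $\delta$. The group $G$ is called $(\ast\ast)$-coverable if there are proper subgroups $H, K$ of $G$ such that $\delta=\{H^g, K^g : g\in G\}$ is a covering of $G$, where $H^g=g^{-1}Hg$. Theorem. Let $n$ be a natural number. The symmetric group $S_n$ is $(\ast\ast)$-coverable if and only if $3\le n\le 6$. -/

import Mathlib

/-- A set `δ` of subgroups of `G` is a covering of `G` if its members are proper subgroups, their
set-theoretical union is `G`, and there are no inclusions between distinct members. -/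
structure IsCovering {G : Type*} [Group G] (δ : Set (Subgroup G)) : Prop where
  proper : ∀ L ∈ δ, L < ⊤
  union_eq : (⋃ L ∈ δ, (L : Set G)) = Set.univ
  no_inclusions : ∀ L ∈ δ, ∀ M ∈ δ, L ≠ M → ¬ L ≤ M

/-- The conjugate `H ^ g = g⁻¹ H g`. -/
def conjSubgroup {G : Type*} [Group G] (H : Subgroup G) (g : G) : Subgroup G :=
  H.map (MulAut.conj g⁻¹).toMonoidHom

/-- The set of subgroups `{H ^ g, K ^ g : g ∈ G}`. -/
def conjFamily {G : Type*} [Group G] (H K : Subgroup G) : Set (Subgroup G) :=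
  {L | ∃ g : G, L = conjSubgroup H g ∨ L = conjSubgroup K g}

/-- `G` is `(∗∗)`-coverable: there are proper subgroups `H`, `K` of `G` such that
`{H ^ g, K ^ g : g ∈ G}` is a covering of `G`. -/
def IsStarStarCoverable (G : Type*) [Group G] : Prop :=
  ∃ H K : Subgroup G, H < ⊤ ∧ K < ⊤ ∧ IsCovering (conjFamily H K)

open Equiv Equiv.Perm MulAction
open scoped Pointwise

/-!
If the conjugates of `H` and `K` cover `S_n`, then every cycle type occurs in `H` or in `K`. For
`n ≥ 7` let `H` be the one containing an `n`-cycle, so that `H` is transitive. A permutation of type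
`{2, n - 2}` (`n` odd) or `{2, 3, n - 5}` (`n` even) has a power that is a transposition, so
by Jordan's theorem a proper primitive subgroup omits these types. Primitivity itself comes from a
cycle moving more than half of the points, because its length is divisible by the size of every
proper block. The types that `H` omits lie in `K` and force `K` to stabilise a set of one, two or
three points. The types that `K` then omits lie in `H` and yield `A_n ≤ H`; but then all odd cycle
types lie in `K`, and the same arguments give `K = S_n`.

For `n = 3, 4, 6` one takes a point stabiliser and the centraliser of a suitable fixed-point-free
permutation, and for `n = 5` the affine group `AGL(1, 5)` and the centraliser of a transposition.
-/

/-- `H` and `K` together meet every conjugacy class of `G`. For subgroups this says that `G` is the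
union of the conjugates of `H` and `K`. -/
def ConjCovers {G : Type*} [Group G] (H K : Subgroup G) : Prop :=
  ∀ σ : G, ∃ g : G, g * σ * g⁻¹ ∈ H ∨ g * σ * g⁻¹ ∈ K

theorem ConjCovers.symm {G : Type*} [Group G] {H K : Subgroup G} (h : ConjCovers H K) :
    ConjCovers K H := fun σ => (h σ).imp fun _ => Or.symm

theorem exists_le_stabilizer_of_not_isPretransitive {α : Type*} [Finite α]
    {H : Subgroup (Perm α)} (hH : ¬ IsPretransitive H α) :
    ∃ S : Set α, 0 < S.ncard ∧ 2 * S.ncard ≤ Nat.card α ∧ H ≤ stabilizer (Perm α) S := by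
  obtain ⟨x, y, hxy⟩ : ∃ x y : α, y ∉ orbit H x := by
    simpa only [isPretransitive_iff, mem_orbit_iff, not_forall] using hH
  have hS : H ≤ stabilizer (Perm α) (orbit H x) := fun g hg => smul_orbit (⟨g, hg⟩ : H) x
  have hx := (Set.ncard_pos (orbit H x).toFinite).2 ⟨x, mem_orbit_self x⟩
  have hy := (Set.ncard_pos (orbit H x)ᶜ.toFinite).2 ⟨y, hxy⟩
  have hcard := (orbit H x).ncard_add_ncard_compl
  by_cases h : 2 * (orbit H x).ncard ≤ Nat.card α
  · exact ⟨_, hx, h, hS⟩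
  · exact ⟨_, hy, by omega, by rwa [stabilizer_compl]⟩

section CycleTypes

variable {α : Type*} [Fintype α] [DecidableEq α] {H K : Subgroup (Perm α)} {m : Multiset ℕ}

/-- `H` contains a permutation with cycle type `m`. As in `Equiv.Perm.cycleType`, fixed points are
omitted from `m`. -/
def HasCycleType (H : Subgroup (Perm α)) (m : Multiset ℕ) : Prop :=
  ∃ σ ∈ H, σ.cycleType = m

theorem HasCycleType.exists_conj_mem {c : Perm α} (h : HasCycleType H c.cycleType) :
    ∃ g : Perm α, g * c * g⁻¹ ∈ H := by
  obtain ⟨σ, hσ, h⟩ := h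
  obtain ⟨g, rfl⟩ := isConj_iff.1 (isConj_iff_cycleType_eq.2 h.symm)
  exact ⟨g, hσ⟩

theorem ConjCovers.hasCycleType (h : ConjCovers H K) (hs : m.sum ≤ Fintype.card α)
    (h2 : ∀ a ∈ m, 2 ≤ a) : HasCycleType H m ∨ HasCycleType K m := by
  obtain ⟨σ, rfl⟩ := (exists_with_cycleType_iff α).2 ⟨hs, h2⟩
  obtain ⟨g, hg | hg⟩ := h σ
  exacts [.inl ⟨_, hg, cycleType_conj⟩, .inr ⟨_, hg, cycleType_conj⟩]

theorem not_hasCycleType_of_le_alternatingGroup (hH : H ≤ alternatingGroup α)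
    (hm : Odd (m.sum + m.card)) : ¬ HasCycleType H m := by
  rintro ⟨σ, hσ, rfl⟩
  have := mem_alternatingGroup.1 (hH hσ)
  rw [sign_of_cycleType, hm.neg_one_pow] at this
  exact absurd this (by decide)

theorem HasCycleType.exists_isCycle {a : ℕ} (h : HasCycleType H (a ::ₘ m))
    (hm : ∀ b ∈ m, a.Coprime b) : ∃ c ∈ H, c.IsCycle ∧ c.support.card = a := by
  obtain ⟨σ, hσ, hσm⟩ := h
  obtain ⟨c, τ, rfl, hd, hc, rfl⟩ := mem_cycleType_iff.1 (hσm ▸ Multiset.mem_cons_self a m)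
  obtain rfl : τ.cycleType = m := by
    rwa [hd.cycleType_mul, hc.cycleType, Multiset.singleton_add, Multiset.cons_inj_right] at hσm
  have hco : c.support.card.Coprime (orderOf τ) := by
    rw [← lcm_cycleType]
    exact (Nat.coprime_multiset_prod_right_iff.2 hm).of_dvd_right
      (Multiset.lcm_dvd.2 fun _ => Multiset.dvd_prod)
  have hpow : (c * τ) ^ orderOf τ = c ^ orderOf τ := by
    rw [hd.commute.mul_pow, pow_orderOf_eq_one, mul_one]
  rw [← hc.orderOf] at hco
  refine ⟨c ^ orderOf τ, hpow ▸ H.pow_mem hσ _, hc.pow_iff.2 hco.symm, ?_⟩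
  rw [support_pow_coprime hco.symm]

theorem HasCycleType.exists_le_sum_of_le_stabilizer {S : Set α} (h : HasCycleType H m)
    (hS : H ≤ stabilizer (Perm α) S) :
    ∃ t ≤ m, t.sum ≤ S.ncard ∧ S.ncard + m.sum ≤ t.sum + Fintype.card α := by
  classical
  obtain ⟨σ, hσ, rfl⟩ := h
  have hσS : ∀ x, σ x ∈ S ↔ x ∈ S := mem_stabilizer_set.1 (hS hσ)
  set σ₁ := σ.subtypePerm hσS
  set σ₂ := σ.subtypePerm (p := (· ∉ S)) fun x => (hσS x).not
  have hd : Disjoint (ofSubtype σ₁) (ofSubtype σ₂) := fun x => by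
    by_cases hx : x ∈ S
    · exact .inr (ofSubtype_apply_of_not_mem _ (not_not_intro hx))
    · exact .inl (ofSubtype_apply_of_not_mem _ hx)
  have hmul : σ = ofSubtype σ₁ * ofSubtype σ₂ := by
    ext x
    by_cases hx : x ∈ S
    · rw [Perm.mul_apply, ofSubtype_apply_of_not_mem σ₂ (not_not_intro hx),
        ofSubtype_apply_of_mem σ₁ hx, subtypePerm_apply]
    · rw [Perm.mul_apply, ofSubtype_apply_of_mem σ₂ hx, subtypePerm_apply,
        ofSubtype_apply_of_not_mem σ₁ ((hσS x).not.2 hx)]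
  have htype : σ.cycleType = σ₁.cycleType + σ₂.cycleType := by
    rw [hmul, hd.cycleType_mul, cycleType_ofSubtype, cycleType_ofSubtype]
  have h₁ : σ₁.cycleType.sum ≤ S.ncard := by
    rw [sum_cycleType, ← Nat.card_coe_set_eq, Nat.card_eq_fintype_card]
    exact Finset.card_le_univ _
  have h₂ : σ₂.cycleType.sum ≤ Sᶜ.ncard := by
    rw [sum_cycleType, ← Nat.card_coe_set_eq, Nat.card_eq_fintype_card]
    exact Finset.card_le_univ _
  have hcard := S.ncard_add_ncard_compl
  rw [Nat.card_eq_fintype_card] at hcard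
  rw [htype, Multiset.sum_add]
  exact ⟨_, Multiset.le_add_right _ _, h₁, by omega⟩

end CycleTypes

section Blocks

variable {α : Type*} [Fintype α] [DecidableEq α] {H : Subgroup (Perm α)} {c : Perm α} {B : Set α}

theorem disjoint_support_or_subset_support_of_isBlock (hH : IsPretransitive H α) (hc : c ∈ H)
    (hcyc : c.IsCycle) (hcard : Fintype.card α < 2 * c.support.card) (hB : IsBlock H B)
    (hB' : B ≠ Set.univ) :
    _root_.Disjoint (c.support : Set α) B ∨ B ⊆ c.support := by
  by_contra! h
  obtain ⟨x, hx, hxB⟩ := Set.not_disjoint_iff.1 h.1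
  obtain ⟨y, hyB, hy⟩ := Set.not_subset.1 h.2
  have hsub : (c.support : Set α) ⊆ B := by
    intro z hz
    obtain ⟨k, rfl⟩ := hcyc.exists_zpow_eq (mem_support.1 hx) (mem_support.1 hz)
    have hfix : (⟨c, hc⟩ ^ k : H) • y = y :=
      zpow_apply_eq_self_of_apply_eq_self (notMem_support.1 hy) k
    have hk : (⟨c, hc⟩ ^ k : H) • B = B :=
      isBlock_iff_smul_eq_of_mem.1 hB hyB (hfix.symm ▸ hyB)
    exact hk ▸ Set.smul_mem_smul_set hxB
  refine hB' (hB.eq_univ_of_card_lt ?_)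
  have hle := Set.ncard_le_ncard hsub
  rw [Set.ncard_coe_finset] at hle
  rw [Nat.card_eq_fintype_card]
  omega

theorem ncard_dvd_card_support_of_isBlock (hH : IsPretransitive H α) (hc : c ∈ H)
    (hcyc : c.IsCycle) (hcard : Fintype.card α < 2 * c.support.card) (hB : IsBlock H B)
    (hne : B.Nonempty) (hB' : B ≠ Set.univ) : B.ncard ∣ c.support.card := by
  have := Fintype.ofFinite (Set.range fun g : H => g • B)
  rw [← Set.ncard_coe_finset, (hB.isBlockSystem hne).left.ncard_eq_finsum (c.support : Set α),
    finsum_eq_sum_of_fintype]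
  refine Finset.dvd_sum fun ⟨_, g, hg⟩ _ => ?_
  subst hg
  have hgB : g • B ≠ Set.univ := by rwa [Ne, Set.smul_set_eq_univ]
  obtain h | h :=
    disjoint_support_or_subset_support_of_isBlock hH hc hcyc hcard (hB.translate g) hgB
  · simp only [h.inter_eq, Set.ncard_empty, dvd_zero]
  · simp only [Set.inter_eq_right.2 h, Set.ncard_smul_set, dvd_refl]

theorem isPreprimitive_of_ncard_block_eq_one {G X : Type*} [Group G] [MulAction G X] [Finite X]
    [IsPretransitive G X]
    (h : ∀ B : Set X, IsBlock G B → B.Nonempty → B ≠ Set.univ → B.ncard = 1) :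
    IsPreprimitive G X where
  isTrivialBlock_of_isBlock {B} hB := by
    obtain rfl | hne := B.eq_empty_or_nonempty
    · exact .inl Set.subsingleton_empty
    · refine or_iff_not_imp_right.2 fun hB' => ?_
      obtain ⟨x, rfl⟩ := Set.ncard_eq_one.1 (h B hB hne hB')
      exact Set.subsingleton_singleton

theorem isPreprimitive_of_isCycle_mem_of_coprime (hH : IsPretransitive H α) (hc : c ∈ H)
    (hcyc : c.IsCycle) (hcard : Fintype.card α < 2 * c.support.card)
    (hco : c.support.card.Coprime (Fintype.card α)) : IsPreprimitive H α :=
  isPreprimitive_of_ncard_block_eq_one fun _ hB hne hB' =>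
    Nat.eq_one_of_dvd_coprimes hco
      (ncard_dvd_card_support_of_isBlock hH hc hcyc hcard hB hne hB')
      (Nat.card_eq_fintype_card (α := α) ▸ hB.ncard_dvd_card hne)

theorem HasCycleType.isPreprimitive {a : ℕ} {m : Multiset ℕ} (h : HasCycleType H (a ::ₘ m))
    (hH : IsPretransitive H α) (hm : ∀ b ∈ m, a.Coprime b)
    (hcard : Fintype.card α < 2 * a) (hco : a.Coprime (Fintype.card α)) :
    IsPreprimitive H α := by
  obtain ⟨c, hc, hcyc, rfl⟩ := h.exists_isCycle hm
  exact isPreprimitive_of_isCycle_mem_of_coprime hH hc hcyc hcard hco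

theorem HasCycleType.eq_top {m : Multiset ℕ} (h : HasCycleType H (2 ::ₘ m))
    (hH : IsPreprimitive H α) (hm : ∀ b ∈ m, Odd b) : H = ⊤ := by
  obtain ⟨c, hc, -, hcard⟩ := h.exists_isCycle fun b hb =>
    Nat.coprime_two_left.2 (hm b hb)
  exact subgroup_eq_top_of_isPreprimitive_of_isSwap_mem hH c (card_support_eq_two.1 hcard) hc

theorem HasCycleType.alternatingGroup_le {m : Multiset ℕ} (h : HasCycleType H (3 ::ₘ m))
    (hH : IsPreprimitive H α) (hm : ∀ b ∈ m, ¬ 3 ∣ b) : alternatingGroup α ≤ H := by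
  obtain ⟨c, hc, -, hcard⟩ := h.exists_isCycle fun b hb =>
    (Nat.Prime.coprime_iff_not_dvd Nat.prime_three).2 (hm b hb)
  exact alternatingGroup_le_of_isPreprimitive_of_isThreeCycle_mem hH
    (card_support_eq_three_iff.1 hcard) hc

end Blocks

theorem conj_swap_mul_swap {α : Type*} [DecidableEq α] (g : Perm α) (x y z w : α) :
    g * (swap x y * swap z w) * g⁻¹ = swap (g x) (g y) * swap (g z) (g w) := by
  rw [← conj_mul, mul_swap_eq_swap_mul, mul_swap_eq_swap_mul, mul_inv_cancel_right,
    mul_inv_cancel_right]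

theorem exists_swap_mul_swap_mem {α : Type*} [DecidableEq α] {H : Subgroup (Perm α)}
    (hH : IsMultiplyPretransitive H α 3) (x : Fin 4 ↪ α)
    (hx : swap (x 0) (x 1) * swap (x 2) (x 3) ∈ H) (y : Fin 3 ↪ α) :
    ∃ w, (∀ i, w ≠ y i) ∧ swap (y 0) (y 1) * swap (y 2) w ∈ H := by
  obtain ⟨⟨g, hg⟩, hgx⟩ := exists_smul_eq H (Fin.castSuccEmb.trans x) y
  have hgx' : ∀ i : Fin 3, g (x i.castSucc) = y i := DFunLike.congr_fun hgx
  refine ⟨g (x 3), fun i => ?_, ?_⟩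
  · rw [← hgx' i]
    exact g.injective.ne (x.injective.ne i.castSucc_lt_last.ne')
  · have := H.mul_mem (H.mul_mem hg hx) (H.inv_mem hg)
    rw [conj_swap_mul_swap] at this
    rwa [← hgx' 0, ← hgx' 1, ← hgx' 2]

section MultipleTransitivity

variable {α : Type*} [Fintype α] [DecidableEq α] {H : Subgroup (Perm α)} {c : Perm α} {k : ℕ}

theorem isMultiplyPretransitive_succ_of_isCycle_mem (hH : IsMultiplyPretransitive H α k)
    (hc : c ∈ H) (hcyc : c.IsCycle) (hk : c.support.card + k = Fintype.card α) :
    IsMultiplyPretransitive H α (k + 1) := by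
  obtain ⟨e, he⟩ : ∃ e : Fin k ↪ α, Set.range e = {x | c x = x} := by
    have hcompl : c.supportᶜ.card = k := by rw [Finset.card_compl]; omega
    refine ⟨(c.supportᶜ.equivFinOfCardEq hcompl).symm.toEmbedding.trans
      (Function.Embedding.subtype _), ?_⟩
    rw [Function.Embedding.coe_trans, Set.range_comp, Equiv.coe_toEmbedding, Equiv.range_eq_univ,
      Set.image_univ, Function.Embedding.coe_subtype, Subtype.range_coe]
    ext x
    simp
  have key : ∀ x : Fin (k + 1) ↪ α, ∃ h : H, (∀ i : Fin k, h • x i.castSucc = e i) ∧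
      h • x (Fin.last k) ∈ c.support := fun x => by
    obtain ⟨h, hh⟩ := exists_smul_eq H (Fin.castSuccEmb.trans x) e
    have hi : ∀ i : Fin k, h • x i.castSucc = e i := fun i => DFunLike.congr_fun hh i
    refine ⟨h, hi, mem_support.2 fun hlast => ?_⟩
    obtain ⟨i, hlast⟩ : h • x (Fin.last k) ∈ Set.range e := he.ge hlast
    rw [← hi, smul_left_cancel_iff, x.apply_eq_iff_eq] at hlast
    exact i.castSucc_lt_last.ne hlast
  refine isMultiplyPretransitive_iff.2 fun x y => ?_
  obtain ⟨g, hg, hgc⟩ := key x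
  obtain ⟨h, hh, hhc⟩ := key y
  obtain ⟨j, hj⟩ := hcyc.exists_zpow_eq (mem_support.1 hgc) (mem_support.1 hhc)
  refine ⟨h⁻¹ * ⟨c, hc⟩ ^ j * g, DFunLike.ext _ _ fun i => ?_⟩
  rw [Function.Embedding.smul_apply, mul_smul, mul_smul, inv_smul_eq_iff]
  cases i using Fin.lastCases with
  | last => exact hj
  | cast i => rw [hg, hh]; exact zpow_apply_eq_self_of_apply_eq_self (he.le ⟨i, rfl⟩) j

theorem HasCycleType.isMultiplyPretransitive_succ {a : ℕ} (h : HasCycleType H {a})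
    (hH : IsMultiplyPretransitive H α k) (hk : a + k = Fintype.card α) :
    IsMultiplyPretransitive H α (k + 1) := by
  obtain ⟨c, hc, hcyc, rfl⟩ := h.exists_isCycle (m := 0) (by simp)
  exact isMultiplyPretransitive_succ_of_isCycle_mem hH hc hcyc hk

theorem isMultiplyPretransitive_of_isCycle_mem_of_prime (hH : IsPreprimitive H α) (hc : c ∈ H)
    (hcyc : c.IsCycle) (hp : c.support.card.Prime)
    (hk : c.support.card + k = Fintype.card α) (hk0 : k ≠ 0) :
    IsMultiplyPretransitive H α (k + 1) := by
  obtain ⟨k, rfl⟩ := Nat.exists_eq_succ_of_ne_zero hk0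
  have hcompl : ((c.support : Set α)ᶜ).ncard = k + 1 := by
    rw [← Finset.coe_compl, Set.ncard_coe_finset, Finset.card_compl]; omega
  have := isPretransitive_of_isCycle_mem hcyc hc
  have hprim : IsPreprimitive (fixingSubgroup H (c.support : Set α)ᶜ)
      (SubMulAction.ofFixingSubgroup H (c.support : Set α)ᶜ) := by
    refine IsPreprimitive.of_prime_card ?_
    convert hp
    refine (Nat.card_coe_set_eq (c.support : Set α)ᶜᶜ).trans ?_
    rw [compl_compl, Set.ncard_coe_finset]
  have hlt : k + 2 < Nat.card α := by
    have := hp.two_le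
    rw [Nat.card_eq_fintype_card]; omega
  have := hH.isMultiplyPreprimitive hcompl hlt hprim
  exact IsMultiplyPreprimitive.isMultiplyPretransitive H α _

theorem alternatingGroup_le_of_isMultiplyPretransitive_four
    (hH : IsMultiplyPretransitive H α 4) (hcard : 5 ≤ Fintype.card α) (x : Fin 4 ↪ α)
    (hx : swap (x 0) (x 1) * swap (x 2) (x 3) ∈ H) : alternatingGroup α ≤ H := by
  obtain ⟨y, hy⟩ : ∃ y, ∀ i, x i ≠ y := by
    by_contra! h
    have := Fintype.card_le_of_surjective x h
    rw [Fintype.card_fin] at this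
    omega
  obtain ⟨⟨g, hg⟩, hgx⟩ := exists_smul_eq H x (x.setValue 3 y)
  have hgx' : ∀ i, g (x i) = x.setValue 3 y i := DFunLike.congr_fun hgx
  have hval : ∀ i ≠ 3, x.setValue 3 y i = x i := fun i hi =>
    x.setValue_eq_of_ne hi (hy i)
  have hxy : swap (x 0) (x 1) * swap (x 2) y ∈ H := by
    have := H.mul_mem (H.mul_mem hg hx) (H.inv_mem hg)
    rwa [conj_swap_mul_swap, hgx', hgx', hgx', hgx', x.setValue_eq, hval 0 (by decide),
      hval 1 (by decide), hval 2 (by decide)] at this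
  have h3 : swap (x 2) (x 3) * swap (x 2) y ∈ H := by
    have := H.mul_mem (H.inv_mem hx) hxy
    rwa [mul_inv_rev, swap_inv, swap_inv, mul_assoc, swap_mul_self_mul] at this
  have := isMultiplyPretransitive_of_le (G := H) (α := α) (n := 4) (m := 2) (by norm_num)
    (by rw [Nat.card_eq_fintype_card]; omega)
  refine alternatingGroup_le_of_isPreprimitive_of_isThreeCycle_mem
    (isPreprimitive_of_is_two_pretransitive this)
    (isThreeCycle_swap_mul_swap_same (x.injective.ne (by decide)) (hy 2) (hy 3)) h3

end MultipleTransitivity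

theorem alternatingGroup_le_of_degree_ten {H : Subgroup (Perm (Fin 10))}
    (hH : IsPreprimitive H (Fin 10)) (h5 : HasCycleType H {5, 4}) (h6 : HasCycleType H {6, 4}) :
    alternatingGroup (Fin 10) ≤ H := by
  obtain ⟨c, hc, hcyc, hcard⟩ := h5.exists_isCycle (by decide)
  have : IsMultiplyPretransitive H (Fin 10) 6 :=
    isMultiplyPretransitive_of_isCycle_mem_of_prime hH hc hcyc (by rw [hcard]; norm_num)
      (by rw [hcard, Fintype.card_fin]) (by norm_num)
  have hH4 : IsMultiplyPretransitive H (Fin 10) 4 :=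
    isMultiplyPretransitive_of_le (n := 6) (by norm_num) (by simp)
  let d : Perm (Fin 10) := c[0, 2, 1, 3] * c[4, 5, 6, 7, 8, 9]
  have hd : d.cycleType = {6, 4} := by decide +kernel
  obtain ⟨g, hg⟩ := (hd ▸ h6).exists_conj_mem
  refine alternatingGroup_le_of_isMultiplyPretransitive_four hH4 (by simp)
    ((Fin.castLEEmb (by norm_num)).trans g.toEmbedding) ?_
  have := H.pow_mem hg 6
  rwa [conj_pow, show d ^ 6 = swap 0 1 * swap 2 3 by decide +kernel, conj_swap_mul_swap] at this

theorem exists_mem_card_support_of_degree_eight {L : Subgroup (Perm (Fin 8))}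
    (hc : c[0, 1, 2, 3, 4, 5] ∈ L) {e : Fin 8} (he0 : e ≠ 0) (he6 : e ≠ 6) (he7 : e ≠ 7)
    (ht : swap 6 7 * swap 0 e ∈ L) : ∃ τ ∈ L, τ.support.card = 2 ∨ τ.support.card = 3 := by
  by_cases he3 : e = 3
  · subst he3
    exact ⟨_, L.pow_mem (L.mul_mem hc ht) 3, .inl (by decide +kernel)⟩
  · -- If `t = (6 7)(0 e)` and `c` is the 6-cycle, then `t * (c ^ e * t * c ^ (-e))` is the 3-cycle
    -- `(0 e)(e 2e)`, entries being read modulo 6.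
    refine ⟨_, L.mul_mem ht (L.mul_mem (L.mul_mem (L.pow_mem hc e) ht)
      (L.inv_mem (L.pow_mem hc e))), .inr ?_⟩
    clear hc ht
    revert e
    decide +kernel

theorem alternatingGroup_le_of_degree_eight {H : Subgroup (Perm (Fin 8))}
    (hH : IsMultiplyPretransitive H (Fin 8) 3) (h6 : HasCycleType H {6})
    (h4 : HasCycleType H {4, 2, 2}) : alternatingGroup (Fin 8) ≤ H := by
  let c : Perm (Fin 8) := c[0, 1, 2, 3, 4, 5]
  have hc : c.cycleType = {6} := by decide +kernel
  obtain ⟨g, hg⟩ := (hc ▸ h6).exists_conj_mem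
  let d : Perm (Fin 8) := c[0, 2, 1, 3] * swap 4 5 * swap 6 7
  have hd : d.cycleType = {4, 2, 2} := by decide +kernel
  obtain ⟨x, hx⟩ := (hd ▸ h4).exists_conj_mem
  have hxswap : swap (x 0) (x 1) * swap (x 2) (x 3) ∈ H := by
    have := H.pow_mem hx 2
    rwa [conj_pow, show d ^ 2 = swap 0 1 * swap 2 3 by decide +kernel, conj_swap_mul_swap] at this
  obtain ⟨w, hw, hmem⟩ := exists_swap_mul_swap_mem hH
    ((Fin.castLEEmb (by norm_num)).trans x.toEmbedding) hxswap
    ((⟨![6, 7, 0], by decide⟩ : Fin 3 ↪ Fin 8).trans g.toEmbedding)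
  obtain ⟨e, rfl⟩ := g.surjective w
  have ht : g * (swap 6 7 * swap 0 e) * g⁻¹ ∈ H := by rwa [conj_swap_mul_swap]
  obtain ⟨τ, hτ, hcard⟩ := exists_mem_card_support_of_degree_eight
    (L := H.comap (MulAut.conj g).toMonoidHom) hg (ne_of_apply_ne g (hw 2))
    (ne_of_apply_ne g (hw 0)) (ne_of_apply_ne g (hw 1)) ht
  have := isMultiplyPretransitive_of_le (G := H) (α := Fin 8) (n := 3) (m := 2) (by norm_num)
    (by simp)
  have hprim := isPreprimitive_of_is_two_pretransitive this
  rw [← card_support_conj (σ := g)] at hcard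
  obtain hcard | hcard := hcard
  · rw [subgroup_eq_top_of_isPreprimitive_of_isSwap_mem hprim _ (card_support_eq_two.1 hcard) hτ]
    exact le_top
  · exact alternatingGroup_le_of_isPreprimitive_of_isThreeCycle_mem hprim
      (card_support_eq_three_iff.1 hcard) hτ

theorem eq_alternatingGroup_of_le_of_ne_top {α : Type*} [Fintype α] [DecidableEq α] [Nontrivial α]
    {H : Subgroup (Perm α)} (h : alternatingGroup α ≤ H) (hH : H ≠ ⊤) : H = alternatingGroup α := by
  have hdvd : H.index ∣ 2 := alternatingGroup.index_eq_two (α := α) ▸ Subgroup.index_dvd_of_le h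
  exact eq_alternatingGroup_of_index_eq_two
    (((Nat.dvd_prime Nat.prime_two).1 hdvd).resolve_left (Subgroup.index_eq_one.not.2 hH))

theorem exists_le_cons {ι : Type*} {a : ι} {m : Multiset ι} {p : Multiset ι → Prop} :
    (∃ t ≤ a ::ₘ m, p t) ↔ (∃ t ≤ m, p t) ∨ ∃ t ≤ m, p (a ::ₘ t) := by
  constructor
  · rintro ⟨t, ht, hp⟩
    by_cases ha : a ∈ t
    · obtain ⟨u, rfl⟩ := Multiset.exists_cons_of_mem ha
      exact .inr ⟨u, (Multiset.cons_le_cons_iff a).1 ht, hp⟩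
    · exact .inl ⟨t, (Multiset.le_cons_of_notMem ha).1 ht, hp⟩
  · rintro (⟨t, ht, hp⟩ | ⟨t, ht, hp⟩)
    · exact ⟨t, ht.trans (Multiset.le_cons_self m a), hp⟩
    · exact ⟨_, Multiset.cons_le_cons a ht, hp⟩

section StabilizedSets

variable {α : Type*} [Fintype α] [DecidableEq α] {H : Subgroup (Perm α)} {S : Set α} {a b c : ℕ}

theorem HasCycleType.le_ncard_of_singleton (h : HasCycleType H {a})
    (hS : H ≤ stabilizer (Perm α) S) : S.ncard + a ≤ Fintype.card α ∨ a ≤ S.ncard := by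
  have := h.exists_le_sum_of_le_stabilizer hS
  simp only [← Multiset.cons_zero, exists_le_cons, Multiset.le_zero, exists_eq_left,
    Multiset.sum_cons, Multiset.sum_zero] at this
  omega

theorem HasCycleType.le_ncard_of_pair (h : HasCycleType H {a, b})
    (hS : H ≤ stabilizer (Perm α) S) :
    S.ncard + (a + b) ≤ Fintype.card α ∨ a ≤ S.ncard ∧ S.ncard + b ≤ Fintype.card α ∨
      b ≤ S.ncard ∧ S.ncard + a ≤ Fintype.card α ∨ a + b ≤ S.ncard := by
  have := h.exists_le_sum_of_le_stabilizer hS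
  simp only [Multiset.insert_eq_cons, ← Multiset.cons_zero, exists_le_cons, Multiset.le_zero,
    exists_eq_left, Multiset.sum_cons, Multiset.sum_zero] at this
  omega

theorem HasCycleType.le_ncard_of_triple (h : HasCycleType H {a, b, c})
    (hS : H ≤ stabilizer (Perm α) S) (hc : a + b + c = Fintype.card α) :
    S.ncard ∈ ({0, a, b, c, a + b, a + c, b + c, a + b + c} : Finset ℕ) := by
  have := h.exists_le_sum_of_le_stabilizer hS
  simp only [Multiset.insert_eq_cons, ← Multiset.cons_zero, exists_le_cons, Multiset.le_zero,
    exists_eq_left, Multiset.sum_cons, Multiset.sum_zero] at this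
  simp only [Finset.mem_insert, Finset.mem_singleton]
  omega

end StabilizedSets

section LargeDegree

variable {n : ℕ} {H K : Subgroup (Perm (Fin n))}

theorem HasCycleType.isPretransitive_of_degree (h : HasCycleType H {n}) :
    IsPretransitive H (Fin n) :=
  is_one_pretransitive_iff.1
    (h.isMultiplyPretransitive_succ (k := 0) is_zero_pretransitive'
      (by rw [Fintype.card_fin, add_zero]))

theorem HasCycleType.isMultiplyPretransitive_two (h : HasCycleType H {n - 1}) (hn : n ≠ 0)
    (hH : IsPretransitive H (Fin n)) : IsMultiplyPretransitive H (Fin n) 2 :=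
  h.isMultiplyPretransitive_succ (is_one_pretransitive_iff.2 hH)
    (by rw [Fintype.card_fin]; omega)

theorem eq_top_of_odd_degree (hn : 7 ≤ n) (hodd : Odd n) (hH : IsPretransitive H (Fin n))
    (h : HasCycleType H {2, n - 2}) : H = ⊤ := by
  have hodd' : Odd (n - 2) := Nat.Odd.sub_even (by omega) hodd even_two
  have hprim : IsPreprimitive H (Fin n) := by
    rw [Multiset.pair_comm] at h
    refine h.isPreprimitive hH ?_ (by rw [Fintype.card_fin]; omega) ?_
    · exact fun b hb => Multiset.mem_singleton.1 hb ▸ Nat.coprime_two_right.2 hodd'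
    · rw [Fintype.card_fin, Nat.coprime_self_sub_left (by omega)]
      exact Nat.coprime_two_left.2 hodd
  exact h.eq_top hprim fun b hb => Multiset.mem_singleton.1 hb ▸ hodd'

theorem isPreprimitive_of_even_degree (hn : 8 ≤ n) (heven : Even n)
    (hH : IsPretransitive H (Fin n)) (h₂ : HasCycleType H {2, n - 3})
    (h₃ : HasCycleType H {2, 3, n - 5}) : IsPreprimitive H (Fin n) := by
  have hodd₃ : Odd (n - 3) := Nat.Even.sub_odd (by omega) heven (by decide)
  have hodd₅ : Odd (n - 5) := Nat.Even.sub_odd (by omega) heven (by decide)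
  rw [Multiset.pair_comm] at h₂
  obtain ⟨c, hc, hcyc, hcard⟩ := h₂.exists_isCycle fun b hb =>
    Multiset.mem_singleton.1 hb ▸ Nat.coprime_two_right.2 hodd₃
  refine isPreprimitive_of_ncard_block_eq_one fun B hB hne hB' => ?_
  have hdvd : B.ncard ∣ n := by simpa only [Nat.card_fin] using hB.ncard_dvd_card hne
  have hdvd₃ : B.ncard ∣ n - 3 := hcard ▸ ncard_dvd_card_support_of_isBlock hH hc hcyc
    (by rw [hcard, Fintype.card_fin]; omega) hB hne hB'
  have : B.ncard ∣ 3 := by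
    simpa only [Nat.sub_sub_self (show 3 ≤ n by omega)] using Nat.dvd_sub hdvd hdvd₃
  refine ((Nat.dvd_prime Nat.prime_three).1 this).resolve_right fun hB3 => ?_
  rw [hB3] at hdvd
  have hndvd : ¬ 3 ∣ n - 5 := by omega
  have hn' : 12 ≤ n := by have := heven.two_dvd; omega
  rw [Multiset.pair_comm 3, Multiset.insert_eq_cons, Multiset.insert_eq_cons,
    Multiset.cons_swap] at h₃
  obtain ⟨d, hd, hdcyc, hdcard⟩ := h₃.exists_isCycle fun b hb => by
    obtain rfl | hb := Multiset.mem_cons.1 hb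
    · exact Nat.coprime_two_right.2 hodd₅
    · rw [Multiset.mem_singleton.1 hb]
      exact ((Nat.Prime.coprime_iff_not_dvd Nat.prime_three).2 hndvd).symm
  have hdvd₅ := ncard_dvd_card_support_of_isBlock hH hd hdcyc
    (by rw [hdcard, Fintype.card_fin]; omega) hB hne hB'
  rw [hdcard, hB3] at hdvd₅
  exact hndvd hdvd₅

theorem HasCycleType.eq_top_of_even_degree (h : HasCycleType H {2, n - 3}) (hn : 8 ≤ n)
    (heven : Even n) (hH : IsPreprimitive H (Fin n)) : H = ⊤ :=
  h.eq_top hH fun _ hb =>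
    Multiset.mem_singleton.1 hb ▸ Nat.Even.sub_odd (by omega) heven (by decide)

theorem HasCycleType.eq_top_of_odd_parts {a b : ℕ} (h : HasCycleType H {2, a, b})
    (hH : IsPreprimitive H (Fin n)) (ha : Odd a) (hb : Odd b) : H = ⊤ :=
  h.eq_top hH fun _ hc => (Multiset.mem_cons.1 hc).elim (fun h => h ▸ ha)
    fun h => Multiset.mem_singleton.1 h ▸ hb

theorem ConjCovers.hasCycleType_singleton {a : ℕ} (h : ConjCovers H K) (ha : 2 ≤ a) (hn : a ≤ n) :
    HasCycleType H {a} ∨ HasCycleType K {a} :=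
  h.hasCycleType (by simpa using hn) (by simpa using ha)

theorem ConjCovers.hasCycleType_pair {a b : ℕ} (h : ConjCovers H K) (ha : 2 ≤ a) (hb : 2 ≤ b)
    (hn : a + b ≤ n) : HasCycleType H {a, b} ∨ HasCycleType K {a, b} :=
  h.hasCycleType (by simpa using hn) (by simpa using ⟨ha, hb⟩)

theorem ConjCovers.hasCycleType_triple {a b c : ℕ} (h : ConjCovers H K) (ha : 2 ≤ a) (hb : 2 ≤ b)
    (hc : 2 ≤ c) (hn : a + b + c ≤ n) : HasCycleType H {a, b, c} ∨ HasCycleType K {a, b, c} :=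
  h.hasCycleType (by simpa [add_assoc] using hn) (by simpa using ⟨ha, hb, hc⟩)

theorem ConjCovers.not_alternatingGroup_le (h : ConjCovers H K) (hn : 7 ≤ n) (hH : H ≠ ⊤)
    (hK : K ≠ ⊤) : ¬ alternatingGroup (Fin n) ≤ H := by
  intro hA
  have : Nontrivial (Fin n) := Fin.nontrivial_iff_two_le.2 (by omega)
  have hodd : ∀ {m}, HasCycleType H m ∨ HasCycleType K m → Odd (m.sum + m.card) →
      HasCycleType K m := fun h hm => h.resolve_left <|
    not_hasCycleType_of_le_alternatingGroup (eq_alternatingGroup_of_le_of_ne_top hA hH).le hm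
  obtain heven | hn_odd := n.even_or_odd
  · have hn8 : 8 ≤ n := by have := heven.two_dvd; omega
    have h₁ := hodd (h.hasCycleType_singleton (a := n) (by omega) le_rfl) heven.add_one
    have h₂ : HasCycleType K {2, n - 3} :=
      hodd (h.hasCycleType_pair le_rfl (by omega) (by omega))
        (by change Odd (2 + (n - 3) + 2); grind)
    have h₃ : HasCycleType K {2, 3, n - 5} :=
      hodd (h.hasCycleType_triple le_rfl (by norm_num) (by omega) (by omega))
        (by change Odd (2 + (3 + (n - 5)) + 3); grind)
    exact hK (h₂.eq_top_of_even_degree hn8 heven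
      (isPreprimitive_of_even_degree hn8 heven h₁.isPretransitive_of_degree h₂ h₃))
  · have h₁ : HasCycleType K {n - 1} := hodd (h.hasCycleType_singleton (by omega) (by omega))
      (by change Odd (n - 1 + 1); grind)
    have h₂ : HasCycleType K {2, n - 2} :=
      hodd (h.hasCycleType_pair le_rfl (by omega) (by omega))
        (by change Odd (2 + (n - 2) + 2); grind)
    refine hK (eq_top_of_odd_degree hn hn_odd ?_ h₂)
    by_contra htrans
    obtain ⟨S, hS0, hSn, hS⟩ := exists_le_stabilizer_of_not_isPretransitive htrans
    have := h₁.le_ncard_of_singleton hS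
    have := h₂.le_ncard_of_pair hS
    rw [Fintype.card_fin] at *
    rw [Nat.card_fin] at hSn
    omega

theorem ConjCovers.alternatingGroup_le_of_le_stabilizer {S : Set (Fin n)} (h : ConjCovers H K)
    (hn : 7 ≤ n) (hH : IsPreprimitive H (Fin n)) (hS : K ≤ stabilizer (Perm (Fin n)) S)
    (hcard : S.ncard = 2) : alternatingGroup (Fin n) ≤ H := by
  obtain ⟨b, hb3, hb, hbn, hbn'⟩ : ∃ b, 3 ≤ b ∧ ¬ 3 ∣ b ∧ 3 + b ≤ n ∧ n ≤ 4 + b := by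
    by_cases h3 : 3 ∣ n
    exacts [⟨n - 4, by omega⟩, ⟨n - 3, by omega⟩]
  refine HasCycleType.alternatingGroup_le (m := {b}) ?_ hH fun c hc =>
    Multiset.mem_singleton.1 hc ▸ hb
  refine (h.hasCycleType_pair (by norm_num) (by omega) hbn).resolve_right fun hK => ?_
  have := hK.le_ncard_of_pair hS
  rw [hcard, Fintype.card_fin] at this
  omega

theorem ConjCovers.not_isPretransitive (h : ConjCovers H K) (hn : 8 ≤ n) (heven : Even n)
    (hH : H ≠ ⊤) (hK : K ≠ ⊤) (hHp : IsPreprimitive H (Fin n)) : ¬ IsPretransitive K (Fin n) := by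
  intro hKt
  have h₂ : HasCycleType K {2, n - 3} :=
    (h.hasCycleType_pair le_rfl (by omega) (by omega)).resolve_left fun hH₂ =>
      hH (hH₂.eq_top_of_even_degree hn heven hHp)
  have h₃ : HasCycleType K {2, 3, n - 5} :=
    (h.hasCycleType_triple le_rfl (by norm_num) (by omega) (by omega)).resolve_left fun hH₃ =>
      hH (hH₃.eq_top_of_odd_parts hHp (by decide) (Nat.Even.sub_odd (by omega) heven (by decide)))
  exact hK (h₂.eq_top_of_even_degree hn heven (isPreprimitive_of_even_degree hn heven hKt h₂ h₃))

theorem ConjCovers.not_hasCycleType_degree_of_odd (h : ConjCovers H K) (hn : 7 ≤ n) (hodd : Odd n)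
    (hH : H ≠ ⊤) (hK : K ≠ ⊤) : ¬ HasCycleType H {n} := by
  intro hHn
  have h₂ : HasCycleType K {2, n - 2} :=
    (h.hasCycleType_pair le_rfl (by omega) (by omega)).resolve_left fun hH₂ =>
      hH (eq_top_of_odd_degree hn hodd hHn.isPretransitive_of_degree hH₂)
  obtain ⟨S, hS0, hSn, hS⟩ := exists_le_stabilizer_of_not_isPretransitive
    fun hKt => hK (eq_top_of_odd_degree hn hodd hKt h₂)
  rw [Nat.card_fin] at hSn
  have hcard : S.ncard = 2 := by
    have := h₂.le_ncard_of_pair hS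
    rw [Fintype.card_fin] at this
    omega
  have h₁ : HasCycleType H {n - 1} :=
    (h.hasCycleType_singleton (by omega) (by omega)).resolve_right fun hK₁ => by
      have := hK₁.le_ncard_of_singleton hS
      rw [Fintype.card_fin] at this
      omega
  have hprim := isPreprimitive_of_is_two_pretransitive
    (h₁.isMultiplyPretransitive_two (by omega) hHn.isPretransitive_of_degree)
  exact h.not_alternatingGroup_le hn hH hK
    (h.alternatingGroup_le_of_le_stabilizer hn hprim hS hcard)

theorem ConjCovers.alternatingGroup_le_of_ncard_eq_three {S : Set (Fin n)} (h : ConjCovers H K)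
    (hn : 8 ≤ n) (heven : Even n) (hH : IsMultiplyPretransitive H (Fin n) 2)
    (hS : K ≤ stabilizer (Perm (Fin n)) S) (hcard : S.ncard = 3) :
    alternatingGroup (Fin n) ≤ H := by
  have hprim := isPreprimitive_of_is_two_pretransitive hH
  obtain rfl | rfl | hn' : n = 8 ∨ n = 10 ∨ 12 ≤ n := by have := heven.two_dvd; omega
  · have h6 : HasCycleType H {6} :=
      (h.hasCycleType_singleton (by norm_num) (by norm_num)).resolve_right fun hK => by
        have := hK.le_ncard_of_singleton hS
        rw [hcard, Fintype.card_fin] at this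
        omega
    have h4 : HasCycleType H {4, 2, 2} :=
      (h.hasCycleType_triple (by norm_num) le_rfl le_rfl (by norm_num)).resolve_right fun hK => by
        have := hK.le_ncard_of_triple hS (by simp)
        rw [hcard] at this
        exact absurd this (by decide)
    exact alternatingGroup_le_of_degree_eight (h6.isMultiplyPretransitive_succ hH (by simp)) h6 h4
  · have h4 : ∀ a ∈ Finset.Icc 5 6, HasCycleType H {a, 4} := fun a ha => by
      rw [Finset.mem_Icc] at ha
      refine (h.hasCycleType_pair (by omega) (by norm_num) (by omega)).resolve_right fun hK => ?_
      have := hK.le_ncard_of_pair hS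
      rw [hcard, Fintype.card_fin] at this
      omega
    exact alternatingGroup_le_of_degree_ten hprim (h4 5 (by decide)) (h4 6 (by decide))
  · have h5 : HasCycleType H {2, 5, n - 7} :=
      (h.hasCycleType_triple le_rfl (by norm_num) (by omega) (by omega)).resolve_right fun hK => by
        have := hK.le_ncard_of_triple hS (by rw [Fintype.card_fin]; omega)
        simp only [hcard, Finset.mem_insert, Finset.mem_singleton] at this
        omega
    rw [h5.eq_top_of_odd_parts hprim (by decide)
      (Nat.Even.sub_odd (by omega) heven (by decide))]
    exact le_top

theorem ConjCovers.not_hasCycleType_pred_degree_of_even (h : ConjCovers H K) (hn : 8 ≤ n)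
    (heven : Even n) (hH : H ≠ ⊤) (hK : K ≠ ⊤) (hHt : IsPretransitive H (Fin n)) :
    ¬ HasCycleType H {n - 1} := by
  intro h₁
  have hH2 := h₁.isMultiplyPretransitive_two (by omega) hHt
  have hprim := isPreprimitive_of_is_two_pretransitive hH2
  obtain ⟨S, hS0, hSn, hS⟩ := exists_le_stabilizer_of_not_isPretransitive
    (h.not_isPretransitive hn heven hH hK hprim)
  rw [Nat.card_fin] at hSn
  have hK₂ := (h.hasCycleType_pair (b := n - 3) le_rfl (by omega) (by omega)).resolve_left
    fun hH₂ => hH (hH₂.eq_top_of_even_degree hn heven hprim)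
  have hK₃ := (h.hasCycleType_triple (b := 3) (c := n - 5) le_rfl (by norm_num) (by omega)
    (by omega)).resolve_left fun hH₃ =>
      hH (hH₃.eq_top_of_odd_parts hprim (by decide) (Nat.Even.sub_odd (by omega) heven (by decide)))
  have hcard : S.ncard = 2 ∨ S.ncard = 3 := by
    have h₂ := hK₂.le_ncard_of_pair hS
    have h₃ := hK₃.le_ncard_of_triple hS (by rw [Fintype.card_fin]; omega)
    rw [Fintype.card_fin] at h₂
    simp only [Finset.mem_insert, Finset.mem_singleton] at h₃
    omega
  refine h.not_alternatingGroup_le (by omega) hH hK ?_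
  exact hcard.elim (h.alternatingGroup_le_of_le_stabilizer (by omega) hprim hS)
    (h.alternatingGroup_le_of_ncard_eq_three hn heven hH2 hS)

theorem exists_two_le_coprime_of_even (hn : 8 ≤ n) (heven : Even n) :
    ∃ k, 2 ≤ k ∧ 2 * k < n ∧ k.Coprime n := by
  obtain ⟨m, rfl⟩ := heven.two_dvd
  have key : ∀ k : ℕ, Odd k → k.Coprime m → k.Coprime (2 * m) := fun k hk hkm =>
    (Nat.coprime_two_right.2 hk).mul_right hkm
  obtain hm | hm := m.even_or_odd
  · refine ⟨m - 1, by omega, by omega, key _ (Nat.Even.sub_odd (by omega) hm odd_one) ?_⟩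
    rw [Nat.coprime_self_sub_left (by omega)]
    exact Nat.coprime_one_left m
  · refine ⟨m - 2, by omega, by omega, key _ (Nat.Odd.sub_even (by omega) hm even_two) ?_⟩
    rw [Nat.coprime_self_sub_left (by omega)]
    exact Nat.coprime_two_left.2 hm

theorem ConjCovers.not_hasCycleType_degree_of_even (h : ConjCovers H K) (hn : 8 ≤ n)
    (heven : Even n) (hH : H ≠ ⊤) (hK : K ≠ ⊤) : ¬ HasCycleType H {n} := by
  intro hHn
  have hHt := hHn.isPretransitive_of_degree
  have hK₁ := (h.hasCycleType_singleton (a := n - 1) (by omega) (by omega)).resolve_left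
    (h.not_hasCycleType_pred_degree_of_even hn heven hH hK hHt)
  have hKt : ¬ IsPretransitive K (Fin n) := fun hKt =>
    h.symm.not_hasCycleType_pred_degree_of_even hn heven hK hH hKt hK₁
  obtain ⟨S, hS0, hSn, hS⟩ := exists_le_stabilizer_of_not_isPretransitive hKt
  rw [Nat.card_fin] at hSn
  have hcard : S.ncard = 1 := by
    have := hK₁.le_ncard_of_singleton hS
    rw [Fintype.card_fin] at this
    omega
  have hH₃ := (h.hasCycleType_triple (a := 2) (b := 3) (c := n - 5) le_rfl (by norm_num)
    (by omega) (by omega)).resolve_right fun hK₃ => by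
      have := hK₃.le_ncard_of_triple hS (by rw [Fintype.card_fin]; omega)
      simp only [hcard, Finset.mem_insert, Finset.mem_singleton] at this
      omega
  obtain ⟨k, hk2, hkn, hk⟩ := exists_two_le_coprime_of_even hn heven
  have hHk := (h.hasCycleType_pair (a := n - k) (b := k) (by omega) hk2 (by omega)).resolve_right
    fun hKk => by
      have := hKk.le_ncard_of_pair hS
      rw [hcard, Fintype.card_fin] at this
      omega
  refine hH (hH₃.eq_top_of_odd_parts (hHk.isPreprimitive hHt ?_ ?_ ?_) (by decide)
    (Nat.Even.sub_odd (by omega) heven (by decide)))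
  · intro b hb
    rw [Multiset.mem_singleton.1 hb, Nat.coprime_sub_self_left (by omega)]
    exact hk.symm
  · rw [Fintype.card_fin]; omega
  · rw [Fintype.card_fin, Nat.coprime_self_sub_left (by omega)]
    exact hk

theorem not_conjCovers (hn : 7 ≤ n) (hH : H ≠ ⊤) (hK : K ≠ ⊤) : ¬ ConjCovers H K := by
  intro h
  have hdeg : ∀ {L M : Subgroup (Perm (Fin n))}, ConjCovers L M → L ≠ ⊤ → M ≠ ⊤ →
      ¬ HasCycleType L {n} := fun h hL hM => by
    obtain heven | hodd := n.even_or_odd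
    · exact h.not_hasCycleType_degree_of_even (by have := heven.two_dvd; omega) heven hL hM
    · exact h.not_hasCycleType_degree_of_odd hn hodd hL hM
  exact (h.hasCycleType_singleton (by omega) le_rfl).elim (hdeg h hH hK) (hdeg h.symm hK hH)

end LargeDegree

section Coverings

variable {G : Type*} [Group G] {H K : Subgroup G}

theorem mem_conjSubgroup {g x : G} : x ∈ conjSubgroup H g ↔ g * x * g⁻¹ ∈ H := by
  rw [conjSubgroup, Subgroup.mem_map_equiv, MulAut.conj_symm_apply, inv_inv]

theorem IsCovering.exists_mem {δ : Set (Subgroup G)} (h : IsCovering δ) (x : G) :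
    ∃ L ∈ δ, x ∈ L := by
  simpa only [Set.mem_iUnion, SetLike.mem_coe, exists_prop] using h.union_eq.ge (Set.mem_univ x)

theorem IsCovering.conjCovers (h : IsCovering (conjFamily H K)) : ConjCovers H K := fun x => by
  obtain ⟨L, ⟨g, rfl | rfl⟩, hx⟩ := h.exists_mem x
  exacts [⟨g, .inl (mem_conjSubgroup.1 hx)⟩, ⟨g, .inr (mem_conjSubgroup.1 hx)⟩]

theorem conjSubgroup_lt_top (hH : H < ⊤) (g : G) : conjSubgroup H g < ⊤ := by
  refine lt_top_iff_ne_top.2 fun h => hH.ne ((Subgroup.eq_top_iff' H).2 fun x => ?_)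
  have : g⁻¹ * x * g ∈ conjSubgroup H g := h ▸ Subgroup.mem_top _
  rwa [mem_conjSubgroup, mul_assoc g⁻¹, mul_inv_cancel_left, mul_inv_cancel_right] at this

theorem conjSubgroup_eq_of_le [Finite G] {g k : G} (h : conjSubgroup H g ≤ conjSubgroup H k) :
    conjSubgroup H g = conjSubgroup H k := by
  refine Subgroup.eq_of_le_of_card_ge h (le_of_eq ?_)
  rw [conjSubgroup, conjSubgroup, Subgroup.card_map_of_injective (MulAut.conj _).injective,
    Subgroup.card_map_of_injective (MulAut.conj _).injective]

theorem not_conjSubgroup_le {x : G} (hx : x ∈ H) (hK : ∀ g : G, g * x * g⁻¹ ∉ K) (g k : G) :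
    ¬ conjSubgroup H g ≤ conjSubgroup K k := by
  intro h
  have hxg : g⁻¹ * x * g ∈ conjSubgroup H g := by
    rwa [mem_conjSubgroup, mul_assoc g⁻¹, mul_inv_cancel_left, mul_inv_cancel_right]
  refine hK (k * g⁻¹) ?_
  simpa only [mul_assoc, mul_inv_rev, inv_inv] using mem_conjSubgroup.1 (h hxg)

theorem ConjCovers.isStarStarCoverable [Finite G] (h : ConjCovers H K) {x y : G} (hx : x ∈ H)
    (hxK : ∀ g : G, g * x * g⁻¹ ∉ K) (hy : y ∈ K) (hyH : ∀ g : G, g * y * g⁻¹ ∉ H) :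
    IsStarStarCoverable G := by
  have hH : H < ⊤ := lt_top_iff_ne_top.2 fun h => hyH 1 (h ▸ Subgroup.mem_top _)
  have hK : K < ⊤ := lt_top_iff_ne_top.2 fun h => hxK 1 (h ▸ Subgroup.mem_top _)
  refine ⟨H, K, hH, hK, ⟨?_, Set.eq_univ_of_forall fun σ => ?_, ?_⟩⟩
  · rintro L ⟨g, rfl | rfl⟩
    exacts [conjSubgroup_lt_top hH g, conjSubgroup_lt_top hK g]
  · obtain ⟨g, hg | hg⟩ := h σ
    · exact Set.mem_biUnion (x := conjSubgroup H g) ⟨g, .inl rfl⟩ (mem_conjSubgroup.2 hg)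
    · exact Set.mem_biUnion (x := conjSubgroup K g) ⟨g, .inr rfl⟩ (mem_conjSubgroup.2 hg)
  · rintro L ⟨g, rfl | rfl⟩ M ⟨k, rfl | rfl⟩ hne hle
    · exact hne (conjSubgroup_eq_of_le hle)
    · exact not_conjSubgroup_le hx hxK g k hle
    · exact not_conjSubgroup_le hy hyH g k hle
    · exact hne (conjSubgroup_eq_of_le hle)

theorem not_isStarStarCoverable_of_isCyclic [IsCyclic G] : ¬ IsStarStarCoverable G := by
  rintro ⟨H, K, -, -, hcov⟩
  obtain ⟨g, hg⟩ := IsCyclic.exists_generator (α := G)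
  obtain ⟨L, hL, hgL⟩ := hcov.exists_mem g
  exact (hcov.proper L hL).not_ge fun x _ => Subgroup.zpowers_le.2 hgL (hg x)

theorem isCyclic_perm_fin {n : ℕ} (hn : n ≤ 2) : IsCyclic (Perm (Fin n)) := by
  have := Fact.mk Nat.prime_two
  refine isCyclic_of_card_dvd_prime (p := 2) ?_
  rw [Nat.card_perm, Nat.card_fin]
  exact Nat.factorial_dvd_factorial hn

theorem mem_normalizer_zpowers_of_conj_eq_zpow [Finite G] {g x : G} {k : ℤ}
    (h : g * x * g⁻¹ = x ^ k) : g ∈ Subgroup.normalizer (Subgroup.zpowers x : Set G) := by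
  refine Subgroup.mem_normalizer_fintype ?_
  rintro _ ⟨m, rfl⟩
  exact ⟨k * m, by simp only [← conj_zpow, h, zpow_mul]⟩

end Coverings

section SmallDegree

variable {α : Type*} [Fintype α] [DecidableEq α] {H K : Subgroup (Perm α)}

theorem hasCycleType_stabilizer_iff {a : α} {σ : Perm α} :
    HasCycleType (stabilizer (Perm α) a) σ.cycleType ↔ ∃ x, σ x = x := by
  constructor
  · intro h
    obtain ⟨g, hg⟩ := h.exists_conj_mem
    rw [mem_stabilizer_iff, mul_smul, mul_smul, smul_eq_iff_eq_inv_smul] at hg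
    exact ⟨g⁻¹ a, hg⟩
  · rintro ⟨x, hx⟩
    refine ⟨swap a x * σ * (swap a x)⁻¹, ?_, cycleType_conj⟩
    rw [mem_stabilizer_iff, Perm.smul_def, Perm.mul_apply, Perm.mul_apply, swap_inv,
      swap_apply_left, hx, swap_apply_right]

theorem isStarStarCoverable_perm {x y : Perm α}
    (h : ∀ σ : Perm α, HasCycleType H σ.cycleType ∨ HasCycleType K σ.cycleType)
    (hx : x ∈ H) (hxK : ¬ HasCycleType K x.cycleType) (hy : y ∈ K)
    (hyH : ¬ HasCycleType H y.cycleType) : IsStarStarCoverable (Perm α) := by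
  refine ConjCovers.isStarStarCoverable (fun σ => ?_) hx (fun g hg => hxK ⟨_, hg, cycleType_conj⟩)
    hy fun g hg => hyH ⟨_, hg, cycleType_conj⟩
  obtain hσ | hσ := h σ
  exacts [hσ.exists_conj_mem.imp fun _ => .inl, hσ.exists_conj_mem.imp fun _ => .inr]

theorem hasCycleType_centralizer_iff {x : Perm α} {m : Multiset ℕ} :
    HasCycleType (Subgroup.centralizer {x}) m ↔ ∃ σ : Perm α, σ * x = x * σ ∧ σ.cycleType = m := by
  simp only [HasCycleType, Subgroup.mem_centralizer_singleton_iff]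

theorem isStarStarCoverable_perm_of_centralizer {x y : Perm α} {a : α}
    (h : ∀ σ : Perm α, (∀ b, σ b ≠ b) → ∃ τ : Perm α, τ * x = x * τ ∧ τ.cycleType = σ.cycleType)
    (hx : ∀ b, x b ≠ b) (hy : y a = a)
    (hyx : ∀ τ : Perm α, τ * x = x * τ → τ.cycleType ≠ y.cycleType) :
    IsStarStarCoverable (Perm α) := by
  refine isStarStarCoverable_perm (H := Subgroup.centralizer {x}) (K := stabilizer (Perm α) a)
    (fun σ => ?_) (Subgroup.mem_centralizer_singleton_iff.2 rfl)
    (hasCycleType_stabilizer_iff.not.2 (not_exists.2 hx)) hy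
    (hasCycleType_centralizer_iff.not.2 fun ⟨τ, hτ, hτy⟩ => hyx τ hτ hτy)
  rw [hasCycleType_stabilizer_iff, hasCycleType_centralizer_iff, or_iff_not_imp_right, not_exists]
  exact h σ

theorem isStarStarCoverable_perm_three : IsStarStarCoverable (Perm (Fin 3)) :=
  isStarStarCoverable_perm_of_centralizer (x := finRotate 3) (y := swap 1 2) (a := 0)
    (by decide +kernel) (by decide) (by decide) (by decide +kernel)

theorem isStarStarCoverable_perm_four : IsStarStarCoverable (Perm (Fin 4)) :=
  isStarStarCoverable_perm_of_centralizer (x := swap 0 2 * swap 1 3) (y := c[1, 2, 3]) (a := 0)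
    (by decide +kernel) (by decide) (by decide) (by decide +kernel)

theorem eq_of_sum_eq_six_of_two_le {m : Multiset ℕ} (h2 : ∀ a ∈ m, 2 ≤ a) (hm : m.sum = 6) :
    m = {6} ∨ m = {4, 2} ∨ m = {3, 3} ∨ m = {2, 2, 2} := by
  have hcard : m.card ≤ 3 := by
    have := Multiset.card_nsmul_le_sum h2
    rw [hm, smul_eq_mul] at this
    omega
  interval_cases h : m.card
  · rw [Multiset.card_eq_zero.1 h] at hm
    exact absurd hm (by decide)
  · obtain ⟨a, rfl⟩ := Multiset.card_eq_one.1 h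
    rw [Multiset.sum_singleton] at hm
    exact .inl (congrArg _ hm)
  · obtain ⟨a, b, rfl⟩ := Multiset.card_eq_two.1 h
    simp only [Multiset.insert_eq_cons, Multiset.forall_mem_cons, Multiset.mem_singleton, forall_eq,
      Multiset.sum_cons, Multiset.sum_singleton] at h2 hm
    have ha : a ≤ 4 := by omega
    obtain rfl : b = 6 - a := by omega
    obtain ⟨h2, -⟩ := h2
    clear h hcard
    interval_cases a <;> decide
  · obtain ⟨a, b, c, rfl⟩ := Multiset.card_eq_three.1 h
    simp only [Multiset.insert_eq_cons, Multiset.forall_mem_cons, Multiset.mem_singleton, forall_eq,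
      Multiset.sum_cons, Multiset.sum_singleton] at h2 hm
    obtain ⟨rfl, rfl, rfl⟩ : a = 2 ∧ b = 2 ∧ c = 2 := by omega
    decide

theorem sum_cycleType_eq_card {σ : Perm α} (h : ∀ a, σ a ≠ a) :
    σ.cycleType.sum = Fintype.card α := by
  rw [sum_cycleType, Finset.card_eq_iff_eq_univ]
  exact Finset.eq_univ_of_forall fun a => mem_support.2 (h a)

theorem isStarStarCoverable_perm_six : IsStarStarCoverable (Perm (Fin 6)) := by
  refine isStarStarCoverable_perm_of_centralizer (x := swap 0 1 * swap 2 3 * swap 4 5)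
    (y := c[1, 2, 3, 4, 5]) (a := 0) (fun σ hσ => ?_) (by decide) (by decide) (by decide +kernel)
  obtain h | h | h | h := eq_of_sum_eq_six_of_two_le (fun _ => two_le_of_mem_cycleType)
    (sum_cycleType_eq_card hσ) <;> rw [h]
  · exact ⟨c[0, 2, 4, 1, 3, 5], by decide +kernel⟩
  · exact ⟨c[0, 2, 1, 3] * swap 4 5, by decide +kernel⟩
  · exact ⟨c[0, 2, 4] * c[1, 3, 5], by decide +kernel⟩
  · exact ⟨swap 0 1 * swap 2 3 * swap 4 5, by decide +kernel⟩

theorem normalizer_zpowers_finRotate_five_ne_top :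
    Subgroup.normalizer (Subgroup.zpowers (finRotate 5) : Set (Perm (Fin 5))) ≠ ⊤ := by
  intro h
  have hmem := (Subgroup.normalizer_eq_top_iff.1 h).conj_mem _ (Subgroup.mem_zpowers _) (swap 0 1)
  have hcomm : swap 0 1 * finRotate 5 * (swap 0 1)⁻¹ * finRotate 5 =
      finRotate 5 * (swap 0 1 * finRotate 5 * (swap 0 1)⁻¹) := by
    obtain ⟨k, hk⟩ := hmem
    rw [← hk]
    exact (Commute.refl _).zpow_left k
  revert hcomm
  decide +kernel

theorem isStarStarCoverable_perm_five : IsStarStarCoverable (Perm (Fin 5)) := by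
  set N := Subgroup.normalizer (Subgroup.zpowers (finRotate 5) : Set (Perm (Fin 5)))
  have h5 : HasCycleType N {5} := ⟨finRotate 5, Subgroup.le_normalizer (Subgroup.mem_zpowers _),
    by decide +kernel⟩
  have h4 : HasCycleType N {4} :=
    ⟨c[1, 2, 4, 3], mem_normalizer_zpowers_of_conj_eq_zpow (k := 2) (by decide +kernel),
      by decide +kernel⟩
  have hN : IsPreprimitive N (Fin 5) :=
    have := h5.isPretransitive_of_degree
    IsPreprimitive.of_prime_card (by rw [Nat.card_fin]; norm_num)
  have h2 : ¬ HasCycleType N {2} := fun h =>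
    normalizer_zpowers_finRotate_five_ne_top (h.eq_top (m := 0) hN (by simp))
  have hK : ∀ m ∈ ([0, {2}, {2, 2}, {3}, {3, 2}] : List (Multiset ℕ)),
      HasCycleType (Subgroup.centralizer {swap (0 : Fin 5) 1}) m := by
    simp only [hasCycleType_centralizer_iff]
    decide +kernel
  have hcases : ∀ σ : Perm (Fin 5), σ.cycleType = {5} ∨ σ.cycleType = {4} ∨
      σ.cycleType ∈ ([0, {2}, {2, 2}, {3}, {3, 2}] : List (Multiset ℕ)) := by
    decide +kernel
  refine isStarStarCoverable_perm (x := finRotate 5) (y := swap 0 1) (fun σ => ?_)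
    (Subgroup.le_normalizer (Subgroup.mem_zpowers _)) ?_
    (Subgroup.mem_centralizer_singleton_iff.2 rfl) ?_
  · obtain h | h | h := hcases σ
    exacts [.inl (h ▸ h5), .inl (h ▸ h4), .inr (hK _ h)]
  · rw [hasCycleType_centralizer_iff]
    decide +kernel
  · rwa [show (swap 0 1 : Perm (Fin 5)).cycleType = {2} by decide +kernel]

end SmallDegree

theorem theorem4p2 (n : ℕ) :
    IsStarStarCoverable (Equiv.Perm (Fin n)) ↔ 3 ≤ n ∧ n ≤ 6 := by
  constructor
  · intro h
    constructor
    · by_contra! hn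
      have := isCyclic_perm_fin (Nat.le_of_lt_succ hn)
      exact not_isStarStarCoverable_of_isCyclic h
    · by_contra! hn
      obtain ⟨H, K, hH, hK, hcov⟩ := h
      exact not_conjCovers hn hH.ne hK.ne hcov.conjCovers
  · rintro ⟨h3, h6⟩
    interval_cases n
    exacts [isStarStarCoverable_perm_three, isStarStarCoverable_perm_four,
      isStarStarCoverable_perm_five, isStarStarCoverable_perm_six]
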